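/- **Theorem 1 (Consistency).** Let $(Y_i,Z_i,X_i)$, $i\ge 1$, be i.i.d. with $Y_i\in\mathbb R$, $Z_i\in\{0,1\}$ and $X_i=(X_{i1},\dots,X_{ip})'\in\mathbb R^p$ ($p$ fixed), and write $(Y,Z,X)$ for a generic copy. *Models.* There is $\alpha^*\in\mathbb R^p$ such that $\pi(x)=\Pr(Z=1\mid X=x)$ satisfies $0<\pi(x)<1$ and $\operatorname{logit}\pi(x)=x'\alpha^*$. For some $\tau\in(0,1)$ there are $\beta^*\in\mathbb R^p$ and $\gamma^*,\delta^*\in\mathbb R$ such that the conditional $\tau$-quantile of the outcome is $Q_\tau(Y\mid X=x,Z=z)=x'\beta^*+\gamma^*z+\delta^*$. (Both hold for almost every value of the conditioning variables.) Let $\mathcal F=\{j:\beta^*_j=0,\ \alpha^*_j\ne0\}$, $\mathcal I=\{j:\beta^*_j=0,\ \alpha^*_j=0\}$ and $\mathcal A^c=\mathcal F\cup\mathcal I$, the covariates unrelated to the outcome quantile. *Estimators.* Let $\hat\beta=\hat\beta^{(n)}\in\mathbb R^p$ be the covariate part of a quantile regression estimate, that is, of a minimizer $(\hat\beta,\hat\gamma,\hat\delta)$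 of $\sum_{i=1}^n\rho_\tau\big(Y_i-(X_i'\beta+\gamma Z_i+\delta)\big)$, $\rho_\tau(u)=u(\tau-\mathbf 1\{u\le 0\})$. Let $\eta>1$, let $\lambda=\lambda_n\ge0$ be deterministic, and put $\hat\omega_j=|\hat\beta_j|^{-\eta}$ (with $0^{-\eta}=\infty$ and $\infty\cdot0=0$). The QOAL estimate $\hat\alpha=\hat\alpha^{(n)}$ is a minimizer over $\alpha\in\mathbb R^p$ of $$\sum_{i=1}^n\big\{-Z_i\,X_i'\alpha+\phi(X_i'\alpha)\big\}+\lambda_n\sum_{j=1}^p\hat\omega_j|\alpha_j|,\qquad \phi(\theta)=\log(1+e^\theta).$$ Both estimators are assumed to be random vectors that are minimizers almost surely for all large $n$. *Regularity conditions.* 1. The Fisher information matrix $E[\phi''(X'\alpha^*)XX']$ exists and is positive definite. 2. $\alpha\mapsto\phi(x'\alpha)$ is three times continuously differentiable at $\alpha^*$ for every $x$. 3. There are a neighbourhood $U$ of $\alpha^*$ and measurable functions $M_1,M_2$ on $\mathbb R^p$ such that, for all $x\in\mathbb R^p$, $\alpha\in U$ and $1\le j,\ell,m\le p$, $$\Big|\tfrac{\partial\phi(x'\alpha)}{\partial\alpha_j}\Big|\le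 M_1(x),\quad \Big|\tfrac{\partial^2\phi(x'\alpha)}{\partial\alpha_j\partial\alpha_\ell}\Big|\le M_1(x),\quad \Big|\tfrac{\partial^3\phi(x'\alpha)}{\partial\alpha_j\partial\alpha_\ell\partial\alpha_m}\Big|\le M_2(x),$$ with $E[M_1(X)]<\infty$ and $E[M_2(X)\mid X_j,X_\ell,X_m]<\infty$ almost surely. 4. $E|X_j|<\infty$ for every $j\in\mathcal A^c$. Assume in addition that $\hat\beta$ is root-$n$ consistent, i.e. $\sqrt n(\hat\beta-\beta^*)=O_p(1)$, and that $\lambda_n/\sqrt n\to0$ and $\lambda_n n^{\eta/2-1}\to\infty$. Then $$\lim_{n\to\infty}\Pr\{\hat\alpha_j=0\ \text{for all } j\in\mathcal A^c\}=1.$$ -/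

import Mathlib

open MeasureTheory ProbabilityTheory Filter Topology
open scoped Matrix ENNReal

noncomputable section

namespace QOAL

/-- The log-partition function of logistic regression, `φ(θ) = log (1 + exp θ)`. -/
def phi (θ : ℝ) : ℝ := Real.log (1 + Real.exp θ)

/-- The log-odds of a probability. -/
def logit (q : ℝ) : ℝ := Real.log (q / (1 - q))

/-- The check function `ρ_τ(u) = u (τ - 1{u ≤ 0})` of quantile regression. -/
def checkFun (τ u : ℝ) : ℝ := u * (τ - Set.indicator (Set.Iic 0) 1 u)

/-- The `τ`-quantile `inf {q : ν(-∞, q] ≥ τ}` of a distribution `ν` on the line. -/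
def quantile (τ : ℝ) (ν : Measure ℝ) : ℝ := sInf {q : ℝ | τ ≤ ν.real (Set.Iic q)}

/-- The partial derivative of `f` with respect to the `j`-th coordinate, as a function of `a`. -/
def partialD {p : ℕ} (j : Fin p) (f : (Fin p → ℝ) → ℝ) (a : Fin p → ℝ) : ℝ :=
  fderiv ℝ f a (Pi.single j 1)

section Criteria

variable {p : ℕ}

/-- The logistic loss (negative log-likelihood) of the observations `i < n`. -/
def logisticLoss (n : ℕ) (x : ℕ → Fin p → ℝ) (z : ℕ → ℝ) (a : Fin p → ℝ) : ℝ :=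
  ∑ i ∈ Finset.range n, (-(z i * (x i ⬝ᵥ a)) + phi (x i ⬝ᵥ a))

/-- The adaptive weight `|b|^(-η)`, with the value `∞` at `b = 0` when `η > 0`. -/
def weight (η b : ℝ) : ℝ≥0∞ := ENNReal.ofReal |b| ^ (-η)

/-- The penalty `lam * ∑ j, |b j|^(-η) * |a j|`, where `∞ * 0 = 0`: a coefficient with an infinite
weight is unpenalized at zero and infinitely penalized elsewhere (if `lam > 0`). -/
def penalty (lam η : ℝ) (b a : Fin p → ℝ) : ℝ≥0∞ :=
  ENNReal.ofReal lam * ∑ j, weight η (b j) * ENNReal.ofReal |a j|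

/-- The criterion of the quantile outcome-adaptive lasso. -/
def criterion (lam η : ℝ) (b : Fin p → ℝ) (n : ℕ) (x : ℕ → Fin p → ℝ) (z : ℕ → ℝ)
    (a : Fin p → ℝ) : EReal :=
  (logisticLoss n x z a : EReal) + (penalty lam η b a : EReal)

/-- `a` is a quantile outcome-adaptive lasso estimate computed from the observations `i < n`, with
regularization parameter `lam`, exponent `η` and outcome-regression coefficients `b`. -/
def IsEstimate (lam η : ℝ) (b : Fin p → ℝ) (n : ℕ) (x : ℕ → Fin p → ℝ) (z : ℕ → ℝ)
    (a : Fin p → ℝ) : Prop :=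
  ∀ a' : Fin p → ℝ, criterion lam η b n x z a ≤ criterion lam η b n x z a'

/-- The empirical check loss of the linear quantile regression of `y` on `x`, `z` and an
intercept, over the observations `i < n`. -/
def quantileLoss (τ : ℝ) (n : ℕ) (y : ℕ → ℝ) (z : ℕ → ℝ) (x : ℕ → Fin p → ℝ)
    (b : Fin p → ℝ) (c d : ℝ) : ℝ :=
  ∑ i ∈ Finset.range n, checkFun τ (y i - (x i ⬝ᵥ b + c * z i + d))

/-- `(b, c, d)` (covariates, treatment, intercept) is a quantile regression estimate. -/
def IsQuantileRegression (τ : ℝ) (n : ℕ) (y : ℕ → ℝ) (z : ℕ → ℝ) (x : ℕ → Fin p → ℝ)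
    (b : Fin p → ℝ) (c d : ℝ) : Prop :=
  ∀ (b' : Fin p → ℝ) (c' d' : ℝ),
    quantileLoss τ n y z x b c d ≤ quantileLoss τ n y z x b' c' d'

/-- Covariates related to the treatment but not to the outcome. -/
def treatmentOnly (αs βs : Fin p → ℝ) : Set (Fin p) := {j | βs j = 0 ∧ αs j ≠ 0}

/-- Covariates related neither to the treatment nor to the outcome. -/
def irrelevant (αs βs : Fin p → ℝ) : Set (Fin p) := {j | βs j = 0 ∧ αs j = 0}

end Criteria

section Model

variable {p : ℕ} {Ω : Type*} [MeasurableSpace Ω]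

/-- The propensity score `π(x) = Pr(Z = 1 | X = x)`. -/
def propensity (P : Measure Ω) [IsFiniteMeasure P] (X : Ω → Fin p → ℝ) (Z : Ω → ℝ)
    (x : Fin p → ℝ) : ℝ :=
  (condDistrib Z X P x).real {1}

/-- The logistic propensity score model with coefficient vector `αs`. -/
def LogisticModel (P : Measure Ω) [IsFiniteMeasure P] (X : Ω → Fin p → ℝ) (Z : Ω → ℝ)
    (αs : Fin p → ℝ) : Prop :=
  ∀ᵐ x ∂(P.map X), 0 < propensity P X Z x ∧ propensity P X Z x < 1 ∧
    logit (propensity P X Z x) = x ⬝ᵥ αs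

/-- The linear model `Q_τ(Y | X = x, Z = z) = x'βs + c z + d` for the conditional quantile. -/
def QuantileModel (P : Measure Ω) [IsFiniteMeasure P] (X : Ω → Fin p → ℝ) (Z Y : Ω → ℝ)
    (τ : ℝ) (βs : Fin p → ℝ) (c d : ℝ) : Prop :=
  ∀ᵐ v ∂(P.map fun ω => (X ω, Z ω)),
    quantile τ (condDistrib Y (fun ω => (X ω, Z ω)) P v) = v.1 ⬝ᵥ βs + c * v.2 + d

/-- The Fisher information matrix `E[φ''(X'αs) X X']`. -/
def fisherInfo (P : Measure Ω) (X : Ω → Fin p → ℝ) (αs : Fin p → ℝ) :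
    Matrix (Fin p) (Fin p) ℝ :=
  Matrix.of fun j l => ∫ ω, iteratedDeriv 2 phi (X ω ⬝ᵥ αs) * (X ω j * X ω l) ∂P

/-- The regularity conditions on the logistic log-partition function at `αs`. -/
structure Regular (P : Measure Ω) [IsFiniteMeasure P] (X : Ω → Fin p → ℝ)
    (αs : Fin p → ℝ) : Prop where
  /-- The Fisher information exists. -/
  fisher_integrable : ∀ j l,
    Integrable (fun ω => iteratedDeriv 2 phi (X ω ⬝ᵥ αs) * (X ω j * X ω l)) P
  /-- The Fisher information is positive definite. -/
  fisher_posDef : (fisherInfo P X αs).PosDef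
  /-- Smoothness up to third order in the parameter. -/
  smooth : ∀ x : Fin p → ℝ, ContDiffAt ℝ 3 (fun a => phi (x ⬝ᵥ a)) αs
  /-- Local domination of the partial derivatives. The conditional expectation of the
  nonnegative part of `M₂ X` given three coordinates, a possibly infinite integral against the
  conditional distribution, is almost surely finite. -/
  dominated : ∃ U ∈ 𝓝 αs, ∃ M₁ M₂ : (Fin p → ℝ) → ℝ,
    Measurable M₁ ∧ Measurable M₂ ∧
    (∀ x, ∀ a ∈ U, ∀ j, |partialD j (fun a => phi (x ⬝ᵥ a)) a| ≤ M₁ x) ∧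
    (∀ x, ∀ a ∈ U, ∀ j l,
      |partialD j (partialD l fun a => phi (x ⬝ᵥ a)) a| ≤ M₁ x) ∧
    (∀ x, ∀ a ∈ U, ∀ j l m,
      |partialD j (partialD l (partialD m fun a => phi (x ⬝ᵥ a))) a| ≤ M₂ x) ∧
    Integrable (fun ω => M₁ (X ω)) P ∧
    ∀ j l m, ∀ᵐ v ∂(P.map fun ω => (X ω j, X ω l, X ω m)),
      ∫⁻ x, ENNReal.ofReal (M₂ x)
        ∂(condDistrib X (fun ω => (X ω j, X ω l, X ω m)) P v) < ∞

/-- `b n` is a root-`n` consistent estimator of `βs`: `√n (b n - βs)` is bounded in probability. -/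
def RootNConsistent (P : Measure Ω) (b : ℕ → Ω → Fin p → ℝ) (βs : Fin p → ℝ) : Prop :=
  ∀ ε : ℝ, 0 < ε → ∃ C : ℝ, ∀ᶠ n : ℕ in atTop,
    P {ω | C < √(n : ℝ) * ‖b n ω - βs‖} ≤ ENNReal.ofReal ε

end Model

end QOAL

end

namespace QOAL

/-! The argument compares a minimizer with the same vector after its `j`-th coordinate is set to
zero. For a binary response the slope of the logistic loss in the linear predictor is `φ' - z ∈ [-1,
1]`, so the change costs at most `|a j| * ∑ |x i j|` in loss, while it saves the weighted penalty on
`a j`. Hence `a j = 0` as soon as `lam` times the weight exceeds `∑ |x i j|` (`IsEstimate.eq_zero`),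
a finite-sample and global statement.

If `βs j = 0`, root-`n` consistency puts the estimated coefficient within `C / √n` of zero with high
probability, so its weight is at least of order `n ^ (η / 2)` (`le_weight`). By Markov's inequality
the sum is only `O_p(n)`, which `lam n * n ^ (η / 2)` dominates because `lam n * n ^ (η / 2 - 1) →
∞` (`tendsto_measureReal_sum_abs_ge`). A union bound over the finitely many coordinates finishes. -/

lemma phi_mono {s t : ℝ} (h : s ≤ t) : phi s ≤ phi t := by
  unfold phi
  gcongr

/-- This is `φ' ≤ 1` in integrated form; it follows from `1 + exp t ≤ (1 + exp s) * exp (t - s)`. -/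
lemma phi_le_phi_add_sub {s t : ℝ} (h : s ≤ t) : phi t ≤ phi s + (t - s) := by
  unfold phi
  have hs := Real.exp_pos s
  have ht := Real.exp_pos t
  have h1 : 1 ≤ Real.exp (t - s) := Real.one_le_exp (by linarith)
  have h2 : Real.exp t = Real.exp s * Real.exp (t - s) := by
    rw [← Real.exp_add]
    ring_nf
  calc Real.log (1 + Real.exp t)
      ≤ Real.log ((1 + Real.exp s) * Real.exp (t - s)) :=
        Real.log_le_log (by positivity) (by rw [h2]; linarith)
    _ = Real.log (1 + Real.exp s) + (t - s) := by
        rw [Real.log_mul (by positivity) (by positivity), Real.log_exp]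

/-- The logistic loss of one binary observation is `1`-Lipschitz in the linear predictor. -/
lemma logistic_term_sub_le {z s t : ℝ} (hz : z = 0 ∨ z = 1) :
    (-(z * s) + phi s) - (-(z * t) + phi t) ≤ |s - t| := by
  rcases le_total s t with h | h
  · have h1 := phi_mono h
    rw [abs_of_nonpos (by linarith)]
    rcases hz with rfl | rfl <;> linarith
  · have h1 := phi_le_phi_add_sub h
    rw [abs_of_nonneg (by linarith)]
    rcases hz with rfl | rfl <;> linarith

/-! ### Deterministic comparison with a vector having one coordinate set to zero -/

variable {p : ℕ}

/-- Setting the `j`-th coefficient to zero raises the logistic loss by at most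
`|a j| * ∑ |x i j|`. -/
lemma logisticLoss_update_zero_le {n : ℕ} {x : ℕ → Fin p → ℝ} {z : ℕ → ℝ}
    (hz : ∀ i, z i = 0 ∨ z i = 1) (a : Fin p → ℝ) (j : Fin p) :
    logisticLoss n x z (Function.update a j 0) ≤
      logisticLoss n x z a + (∑ i ∈ Finset.range n, |x i j|) * |a j| := by
  unfold logisticLoss
  rw [Finset.sum_mul, ← Finset.sum_add_distrib]
  refine Finset.sum_le_sum fun i _ => ?_
  have hupd : Function.update a j 0 = a - Pi.single j (a j) := by
    ext k
    by_cases hk : k = j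
    · subst hk; simp
    · simp [hk]
  have hdot : x i ⬝ᵥ Function.update a j 0 - x i ⬝ᵥ a = -(x i j * a j) := by
    rw [hupd, dotProduct_sub, dotProduct_single]
    ring
  have h := logistic_term_sub_le (s := x i ⬝ᵥ Function.update a j 0) (t := x i ⬝ᵥ a) (hz i)
  rw [hdot, abs_neg, abs_mul] at h
  linarith

/-- The sum form, rather than a difference, remains meaningful when weights are infinite. -/
lemma penalty_update_zero (lam η : ℝ) (b a : Fin p → ℝ) (j : Fin p) :
    penalty lam η b a = penalty lam η b (Function.update a j 0) +
      ENNReal.ofReal lam * weight η (b j) * ENNReal.ofReal |a j| := by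
  unfold penalty
  rw [← Finset.add_sum_erase _ _ (Finset.mem_univ j),
    ← Finset.add_sum_erase (a := j) (f := fun k => weight η (b k) *
      ENNReal.ofReal |Function.update a j 0 k|) _ (Finset.mem_univ j)]
  have h : ∑ k ∈ Finset.univ.erase j, weight η (b k) *
      ENNReal.ofReal |Function.update a j 0 k| =
      ∑ k ∈ Finset.univ.erase j, weight η (b k) * ENNReal.ofReal |a k| :=
    Finset.sum_congr rfl fun k hk => by
      rw [Function.update_of_ne (Finset.ne_of_mem_erase hk)]
  rw [h]
  simp only [Function.update_self, abs_zero, ENNReal.ofReal_zero, mul_zero, zero_add]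
  ring

/-- The zero vector has finite criterion even with infinite weights, since `∞ * 0 = 0`. -/
lemma IsEstimate.penalty_ne_top {lam η : ℝ} {b : Fin p → ℝ} {n : ℕ} {x : ℕ → Fin p → ℝ}
    {z : ℕ → ℝ} {a : Fin p → ℝ} (ha : IsEstimate lam η b n x z a) :
    penalty lam η b a ≠ ∞ := by
  intro htop
  have h := ha 0
  have h0 : penalty lam η b 0 = 0 := by simp [penalty]
  simp only [criterion, htop, h0, EReal.coe_ennreal_top, EReal.coe_add_top,
    EReal.coe_ennreal_zero, add_zero, top_le_iff] at h
  exact EReal.coe_ne_top _ h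

/-- A coefficient whose penalty slope exceeds the Lipschitz constant of the loss is estimated
as zero. -/
lemma IsEstimate.eq_zero {lam η : ℝ} {b : Fin p → ℝ} {n : ℕ} {x : ℕ → Fin p → ℝ}
    {z : ℕ → ℝ} {a : Fin p → ℝ} (ha : IsEstimate lam η b n x z a)
    (hz : ∀ i, z i = 0 ∨ z i = 1) {j : Fin p}
    (hj : ENNReal.ofReal (∑ i ∈ Finset.range n, |x i j|) <
      ENNReal.ofReal lam * weight η (b j)) :
    a j = 0 := by
  by_contra hne
  have hpos : 0 < |a j| := abs_pos.mpr hne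
  have hfin := ha.penalty_ne_top
  have hle := ha (Function.update a j 0)
  have hsplit := penalty_update_zero lam η b a j
  have hlt : ENNReal.ofReal ((∑ i ∈ Finset.range n, |x i j|) * |a j|) <
      ENNReal.ofReal lam * weight η (b j) * ENNReal.ofReal |a j| := by
    rw [ENNReal.ofReal_mul (Finset.sum_nonneg fun i _ => abs_nonneg _)]
    exact ENNReal.mul_lt_mul_left (by simpa using hne) ENNReal.ofReal_ne_top hj
  have hloss := logisticLoss_update_zero_le (n := n) (x := x) hz a j
  -- The weight itself may be infinite; only its product with `|a j|`, a summand of the finite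
  -- penalty, is known to be finite. It is therefore treated as a single number.
  generalize ENNReal.ofReal lam * weight η (b j) * ENNReal.ofReal |a j| = q at hsplit hlt
  have hq : q ≠ ∞ := fun h => hfin (by rw [hsplit, h, add_top])
  have hr : penalty lam η b (Function.update a j 0) ≠ ∞ :=
    fun h => hfin (by rw [hsplit, h, top_add])
  rw [criterion, criterion, hsplit] at hle
  lift q to NNReal using hq
  lift penalty lam η b (Function.update a j 0) to NNReal using hr with r
  have hcoe : ∀ u : NNReal, (((u : ℝ≥0∞) : EReal)) = ((u : ℝ) : EReal) := fun _ => rfl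
  rw [← ENNReal.coe_add, hcoe, hcoe, ← EReal.coe_add, ← EReal.coe_add,
    EReal.coe_le_coe_iff] at hle
  rw [ENNReal.ofReal_lt_iff_lt_toReal (by positivity) ENNReal.coe_ne_top] at hlt
  simp only [ENNReal.coe_toReal, NNReal.coe_add] at hle hlt
  linarith

/-- An estimator of a zero coefficient within `C / √n` of it has a weight of order at least
`n ^ (η / 2)`. -/
lemma le_weight {η C b : ℝ} {n : ℕ} (hη : 0 < η) (hC : 0 < C) (hn : 0 < n)
    (hb : √(n : ℝ) * |b| ≤ C) :
    ENNReal.ofReal (C ^ (-η) * (n : ℝ) ^ (η / 2)) ≤ weight η b := by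
  have hn' : (0 : ℝ) < n := by exact_mod_cast hn
  have hs : 0 < √(n : ℝ) := Real.sqrt_pos.mpr hn'
  have hb' : |b| ≤ C / √(n : ℝ) := by
    rw [le_div_iff₀ hs]
    linarith
  have heq : C ^ (-η) * (n : ℝ) ^ (η / 2) = (C / √(n : ℝ)) ^ (-η) := by
    have hsqrt : √(n : ℝ) ^ η = (n : ℝ) ^ (η / 2) := by
      rw [Real.sqrt_eq_rpow, ← Real.rpow_mul hn'.le]
      ring_nf
    rw [Real.div_rpow hC.le hs.le, Real.rpow_neg hs.le, div_inv_eq_mul, hsqrt]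
  rw [heq, ← ENNReal.ofReal_rpow_of_pos (by positivity)]
  unfold weight
  -- Inversion in `ℝ≥0∞` reverses order with no positivity condition, which covers `b = 0` and its
  -- infinite weight.
  rw [ENNReal.rpow_neg, ENNReal.rpow_neg, ENNReal.inv_le_inv]
  gcongr

/-! ### Markov bounds for the sums of absolute covariates -/

variable {Ω : Type*} [MeasurableSpace Ω]

lemma measureReal_sum_abs_ge_le {P : Measure Ω} [IsProbabilityMeasure P]
    {W : ℕ → Ω → ℝ} (hW : ∀ i, IdentDistrib (W i) (W 0) P P) (hint : Integrable (W 0) P)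
    (n : ℕ) {t : ℝ} (ht : 0 < t) :
    P.real {ω | t ≤ ∑ i ∈ Finset.range n, |W i ω|} ≤ n * (∫ ω, |W 0 ω| ∂P) / t := by
  have hi : ∀ i, Integrable (fun ω => |W i ω|) P := fun i =>
    ((hW i).integrable_iff.mpr hint).abs
  have h := mul_meas_ge_le_integral_of_nonneg (μ := P)
    (f := fun ω => ∑ i ∈ Finset.range n, |W i ω|)
    (Eventually.of_forall fun ω => Finset.sum_nonneg fun i _ => abs_nonneg _)
    (integrable_finsetSum _ fun i _ => hi i) t
  have habs : ∀ i, ∫ ω, |W i ω| ∂P = ∫ ω, |W 0 ω| ∂P := fun i =>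
    ((hW i).comp measurable_abs).integral_eq
  rw [integral_finsetSum _ fun i _ => hi i, Finset.sum_congr rfl fun i _ => habs i] at h
  rw [le_div_iff₀ ht]
  simpa [mul_comm] using h

/-- At this threshold the factor `n` in the Markov bound cancels, leaving a constant divided by `lam
n * n ^ (η / 2 - 1)`. -/
lemma tendsto_measureReal_sum_abs_ge {P : Measure Ω} [IsProbabilityMeasure P]
    {W : ℕ → Ω → ℝ} (hW : ∀ i, IdentDistrib (W i) (W 0) P P) (hint : Integrable (W 0) P)
    {η : ℝ} {lam : ℕ → ℝ}
    (hlam : Tendsto (fun n : ℕ => lam n * (n : ℝ) ^ (η / 2 - 1)) atTop atTop)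
    {c : ℝ} (hc : 0 < c) :
    Tendsto (fun n : ℕ => P.real {ω | lam n * (c * (n : ℝ) ^ (η / 2)) ≤
      ∑ i ∈ Finset.range n, |W i ω|}) atTop (𝓝 0) := by
  have hlim : Tendsto (fun n : ℕ => (∫ ω, |W 0 ω| ∂P) / c / (lam n * (n : ℝ) ^ (η / 2 - 1)))
      atTop (𝓝 0) := hlam.const_div_atTop _
  refine squeeze_zero' (Eventually.of_forall fun n => measureReal_nonneg) ?_ hlim
  filter_upwards [hlam.eventually_gt_atTop 0, eventually_gt_atTop 0] with n hpos hn
  have hn' : (0 : ℝ) < n := by exact_mod_cast hn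
  have hpow : (n : ℝ) ^ (η / 2) = n * (n : ℝ) ^ (η / 2 - 1) := by
    rw [Real.rpow_sub_one hn'.ne']
    field_simp
  have heq : lam n * (c * (n : ℝ) ^ (η / 2)) = n * (c * (lam n * (n : ℝ) ^ (η / 2 - 1))) := by
    rw [hpow]
    ring
  rw [heq]
  refine (measureReal_sum_abs_ge_le hW hint n (by positivity)).trans_eq ?_
  rw [mul_div_mul_left _ _ hn'.ne', div_div]

end QOAL

/-! ### Combination of the bounds -/

theorem theorem1 {p : ℕ} {Ω : Type*} [MeasurableSpace Ω]
    (P : Measure Ω) [IsProbabilityMeasure P]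
    -- the observations
    (Y Z : ℕ → Ω → ℝ) (X : ℕ → Ω → Fin p → ℝ)
    (hY : ∀ i, Measurable (Y i)) (hZ : ∀ i, Measurable (Z i)) (hX : ∀ i, Measurable (X i))
    (hbin : ∀ i, ∀ᵐ ω ∂P, Z i ω = 0 ∨ Z i ω = 1)
    (hindep : iIndepFun (fun i ω => (Y i ω, Z i ω, X i ω)) P)
    (hident : ∀ i, IdentDistrib (fun ω => (Y i ω, Z i ω, X i ω))
      (fun ω => (Y 0 ω, Z 0 ω, X 0 ω)) P P)
    -- the propensity score model and the outcome model
    (αs : Fin p → ℝ) (hlogit : QOAL.LogisticModel P (X 0) (Z 0) αs)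
    (τ : ℝ) (hτ : τ ∈ Set.Ioo (0 : ℝ) 1) (βs : Fin p → ℝ) (γs δs : ℝ)
    (hquant : QOAL.QuantileModel P (X 0) (Z 0) (Y 0) τ βs γs δs)
    -- the regularity conditions
    (hreg : QOAL.Regular P (X 0) αs)
    (hmom : ∀ j ∈ QOAL.treatmentOnly αs βs ∪ QOAL.irrelevant αs βs,
      Integrable (fun ω => X 0 ω j) P)
    -- the regularization parameters
    (η : ℝ) (hη : 1 < η) (lam : ℕ → ℝ) (hlam : ∀ n, 0 ≤ lam n)
    (hlam_small : Tendsto (fun n : ℕ => lam n / √(n : ℝ)) atTop (𝓝 0))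
    (hlam_large : Tendsto (fun n : ℕ => lam n * (n : ℝ) ^ (η / 2 - 1)) atTop atTop)
    -- the quantile regression estimates: covariates, treatment, intercept
    (βhat : ℕ → Ω → Fin p → ℝ) (γhat δhat : ℕ → Ω → ℝ)
    (hβmeas : ∀ n, Measurable (βhat n))
    (hβ : ∀ᶠ n in atTop, ∀ᵐ ω ∂P, QOAL.IsQuantileRegression τ n
      (fun i => Y i ω) (fun i => Z i ω) (fun i => X i ω) (βhat n ω) (γhat n ω) (δhat n ω))
    (hβroot : QOAL.RootNConsistent P βhat βs)
    -- the penalized logistic estimates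
    (αhat : ℕ → Ω → Fin p → ℝ) (hαmeas : ∀ n, Measurable (αhat n))
    (hα : ∀ᶠ n in atTop, ∀ᵐ ω ∂P, QOAL.IsEstimate (lam n) η (βhat n ω) n
      (fun i => X i ω) (fun i => Z i ω) (αhat n ω)) :
    Tendsto
      (fun n => P {ω | ∀ j ∈ QOAL.treatmentOnly αs βs ∪ QOAL.irrelevant αs βs,
        αhat n ω j = 0})
      atTop (𝓝 1) := by
  classical
  set A : Set (Fin p) := QOAL.treatmentOnly αs βs ∪ QOAL.irrelevant αs βs with hA
  have hβA : ∀ j ∈ A, βs j = 0 := by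
    rintro j (h | h) <;> exact h.1
  have hηpos : 0 < η := by linarith
  set S : ℕ → Set Ω := fun n => {ω | ∀ j ∈ A, αhat n ω j = 0} with hS
  have hSmeas : ∀ n, MeasurableSet (S n) := fun n => by
    have : S n = ⋂ j ∈ A, (fun ω => αhat n ω j) ⁻¹' {0} := by
      ext ω
      simp [hS]
    rw [this]
    exact MeasurableSet.biInter A.to_countable fun j _ =>
      (measurable_pi_iff.mp (hαmeas n) j) (measurableSet_singleton 0)
  have hident_coord : ∀ j i, IdentDistrib (fun ω => X i ω j) (fun ω => X 0 ω j) P P :=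
    fun j i => (hident i).comp (u := fun v : ℝ × ℝ × (Fin p → ℝ) => v.2.2 j) (by fun_prop)
  have hcompl : Tendsto (fun n => P.real (S n)ᶜ) atTop (𝓝 0) := by
    rw [Metric.tendsto_atTop']
    suffices h : ∀ ε > 0, ∀ᶠ n in atTop, P.real (S n)ᶜ < ε by
      intro ε hε
      obtain ⟨N, hN⟩ := eventually_atTop.mp (h ε hε)
      exact ⟨N, fun n hn => by
        rw [Real.dist_0_eq_abs, abs_of_nonneg measureReal_nonneg]
        exact hN n hn.le⟩
    intro ε hε
    obtain ⟨C₀, hC₀⟩ := hβroot (ε / 2) (by linarith)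
    -- The constant `C₀` need not be positive, whereas `C ^ (-η)` must be.
    set C := max C₀ 1 with hC
    have hCpos : 0 < C := lt_of_lt_of_le one_pos (le_max_right _ _)
    set s : Finset (Fin p) := Finset.univ.filter (· ∈ A) with hs
    set B : ℕ → Set Ω := fun n => {ω | C₀ < √(n : ℝ) * ‖βhat n ω - βs‖}
    set D : Fin p → ℕ → Set Ω := fun j n =>
      {ω | lam n * (C ^ (-η) * (n : ℝ) ^ (η / 2)) ≤ ∑ i ∈ Finset.range n, |X i ω j|}
    have hD : Tendsto (fun n => ∑ j ∈ s, P.real (D j n)) atTop (𝓝 0) := by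
      rw [← Finset.sum_const_zero (ι := Fin p) (s := s)]
      refine tendsto_finsetSum _ fun j hj => ?_
      exact QOAL.tendsto_measureReal_sum_abs_ge (W := fun i ω => X i ω j) (hident_coord j)
        (hmom j (Finset.mem_filter.mp hj).2) hlam_large (by positivity)
    filter_upwards [hC₀, hD.eventually_lt_const (half_pos hε), hα, eventually_gt_atTop 0]
      with n hBn hDn hαn hn
    -- Failure forces either a large error of `βhat n` or a large covariate sum. The inclusion is
    -- only almost sure because minimality and `Z ∈ {0, 1}` are.
    have hsub : (S n)ᶜ ≤ᵐ[P] (B n ∪ ⋃ j ∈ s, D j n : Set Ω) := by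
      filter_upwards [hαn, ae_all_iff.mpr hbin] with ω hest hz hω
      by_contra hgood
      refine hω fun j hj => hest.eq_zero hz ?_
      obtain ⟨hB, hDj⟩ := not_or.mp hgood
      have hDj' : ¬ lam n * (C ^ (-η) * (n : ℝ) ^ (η / 2)) ≤
          ∑ i ∈ Finset.range n, |X i ω j| := fun h =>
        hDj (Set.mem_biUnion (Finset.mem_filter.mpr ⟨Finset.mem_univ j, hj⟩) h)
      have hb : √(n : ℝ) * |βhat n ω j| ≤ C := by
        -- The norm is the sup norm and `βs j = 0`.
        have h1 : |βhat n ω j| ≤ ‖βhat n ω - βs‖ := by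
          simpa [hβA j hj] using norm_le_pi_norm (βhat n ω - βs) j
        calc √(n : ℝ) * |βhat n ω j| ≤ √(n : ℝ) * ‖βhat n ω - βs‖ := by gcongr
          _ ≤ C₀ := not_lt.mp hB
          _ ≤ C := le_max_left _ _
      calc ENNReal.ofReal (∑ i ∈ Finset.range n, |X i ω j|)
          < ENNReal.ofReal (lam n * (C ^ (-η) * (n : ℝ) ^ (η / 2))) :=
            ENNReal.ofReal_lt_ofReal_iff'.mpr ⟨not_le.mp hDj',
              (Finset.sum_nonneg fun i _ => abs_nonneg _).trans_lt (not_le.mp hDj')⟩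
        _ = ENNReal.ofReal (lam n) * ENNReal.ofReal (C ^ (-η) * (n : ℝ) ^ (η / 2)) :=
            ENNReal.ofReal_mul (hlam n)
        _ ≤ ENNReal.ofReal (lam n) * QOAL.weight η (βhat n ω j) := by
            gcongr
            exact QOAL.le_weight hηpos hCpos hn hb
    have hBreal : P.real (B n) ≤ ε / 2 := ENNReal.toReal_le_of_le_ofReal (by linarith) hBn
    calc P.real (S n)ᶜ ≤ P.real (B n ∪ ⋃ j ∈ s, D j n) :=
          ENNReal.toReal_mono (measure_ne_top _ _) (measure_mono_ae hsub)
      _ ≤ P.real (B n) + P.real (⋃ j ∈ s, D j n) := measureReal_union_le _ _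
      _ ≤ P.real (B n) + ∑ j ∈ s, P.real (D j n) := by
          gcongr
          exact measureReal_biUnion_finset_le _ _
      _ < ε := by linarith
  have hreal : Tendsto (fun n => P.real (S n)) atTop (𝓝 1) := by
    have h := hcompl.const_sub 1
    rw [sub_zero] at h
    refine h.congr fun n => ?_
    rw [probReal_compl_eq_one_sub (hSmeas n)]
    ring
  rw [← ENNReal.toReal_one] at hreal
  exact (ENNReal.tendsto_toReal_iff (fun n => measure_ne_top _ _) ENNReal.one_ne_top).mp hreal
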